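/- Let $\mathbb{G}$ be a two step stratified group, that is, a connected, simply connected Lie group whose finite dimensional real Lie algebra is $\mathfrak{g}=V_1\oplus V_2$ with $[V_1,V_1]=V_2\neq\{0\}$ and $[V_1,V_2]=\{0\}$; it is identified with $\mathfrak{g}$ through the exponential mapping, so that $\exp X\,\exp Y=\exp\big(X+Y+\tfrac12[X,Y]\big)$, and it carries the dilations $\delta_r(\exp(v_1+v_2))=\exp(rv_1+r^2v_2)$ for $r>0$, $v_j\in V_j$. Let $\rho$ be a homogeneous distance on $\mathbb{G}$, i.e. a continuous distance with $\rho(ux,uy)=\rho(x,y)$ and $\rho(\delta_rx,\delta_ry)=r\,\rho(x,y)$ for all $u,x,y\in\mathbb{G}$ and $r>0$. Hausdorff measures $\mathcal{H}^s$ and the Hausdorff dimension are taken with respect to $\rho$. Let $(W_1,\dots,W_q)$ be a basis of $\mathfrak{g}$ with each $W_i$ in $V_1$ or $V_2$, and set $d_i=j$ if $W_i\in V_j$. For a $p$-vector $\tau=\sum_J\tau_J\,W_{j_1}\wedge\dots\wedge W_{j_p}\neq0$, with $J=\{j_1<\dots<j_p\}$, the degree of $\tau$ is $\max\{d_{j_1}+\dots+d_{j_p}\mid\tau_J\neq0\}$.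 For a $p$-dimensional submanifold $\Sigma\subset\mathbb{G}$, the degree $d_\Sigma(x)$ of $\Sigma$ at $x\in\Sigma$ is the degree of $t_1\wedge\dots\wedge t_p$, where $(t_1,\dots,t_p)$ is any basis of $T_x\Sigma$, regarded as a subspace of $\mathfrak{g}$ through left invariant vector fields. Let $\Sigma$ be a $p$-dimensional $C^{1,1}$ (embedded) submanifold of $\mathbb{G}$, that is, $\Sigma$ is locally the zero set of a $C^1$ mapping with values in $\mathbb{R}^{q-p}$ whose differential is Lipschitz continuous and is surjective on the zero set. Let $\delta$ be a positive integer. Then the set $$Z_\delta=\{x\in\Sigma\mid d_\Sigma(x)\le\delta\}$$ is countably $\mathcal{H}^\delta$-finite, i.e. it is a countable union of sets of finite $\mathcal{H}^\delta$ measure. In particular, the Hausdorff dimension of $Z_\delta$ is at most $\delta$. -/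

import Mathlib

open Set Filter Topology MeasureTheory
open scoped NNReal ENNReal

noncomputable section

/-- A stratification of step exactly two of a real Lie algebra `𝔤`:
`𝔤 = V₁ ⊕ V₂`, `[V₁, V₁] = V₂ ≠ 0`, `[V₁, V₂] = 0`. -/
structure TwoStepStratification (𝔤 : Type*) [LieRing 𝔤] [LieAlgebra ℝ 𝔤] where
  V₁ : Submodule ℝ 𝔤
  V₂ : Submodule ℝ 𝔤
  isCompl : IsCompl V₁ V₂
  lie_V₁_V₁ : Submodule.span ℝ {z : 𝔤 | ∃ x ∈ V₁, ∃ y ∈ V₁, ⁅x, y⁆ = z} = V₂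
  lie_V₁_V₂ : ∀ x ∈ V₁, ∀ y ∈ V₂, ⁅x, y⁆ = 0
  V₂_ne_bot : V₂ ≠ ⊥

namespace TwoStepStratification

variable {𝔤 : Type*} [LieRing 𝔤] [LieAlgebra ℝ 𝔤] (S : TwoStepStratification 𝔤)

theorem lie_lie_V₁ (z a b : 𝔤) (hz : z ∈ S.V₂) (ha : a ∈ S.V₁) (hb : b ∈ S.V₁) :
    ⁅z, ⁅a, b⁆⁆ = 0 := by
  have h1 : ⁅z, a⁆ = 0 := by rw [← lie_skew, S.lie_V₁_V₂ a ha z hz, neg_zero]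
  have h2 : ⁅z, b⁆ = 0 := by rw [← lie_skew, S.lie_V₁_V₂ b hb z hz, neg_zero]
  rw [leibniz_lie, h1, h2, zero_lie, lie_zero, add_zero]

/-- The second layer is central. -/
theorem lie_mem_V₂ (x y : 𝔤) (hy : y ∈ S.V₂) : ⁅x, y⁆ = 0 := by
  have h22 : ∀ z ∈ S.V₂, ∀ w ∈ S.V₂, ⁅z, w⁆ = 0 := by
    intro z hz w hw
    rw [← S.lie_V₁_V₁] at hw
    induction hw using Submodule.span_induction with
    | mem w hw =>
      obtain ⟨a, ha, b, hb, rfl⟩ := hw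
      exact S.lie_lie_V₁ z a b hz ha hb
    | zero => exact lie_zero z
    | add u v _ _ hu hv => rw [lie_add, hu, hv, add_zero]
    | smul c u _ hu => rw [lie_smul, hu, smul_zero]
  have hx : x ∈ S.V₁ ⊔ S.V₂ := by rw [S.isCompl.sup_eq_top]; trivial
  obtain ⟨x₁, hx₁, x₂, hx₂, rfl⟩ := Submodule.mem_sup.mp hx
  rw [add_lie, S.lie_V₁_V₂ x₁ hx₁ y hy, h22 x₂ hx₂ y hy, add_zero]

theorem lie_mem (x y : 𝔤) : ⁅x, y⁆ ∈ S.V₂ := by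
  have hx : x ∈ S.V₁ ⊔ S.V₂ := by rw [S.isCompl.sup_eq_top]; trivial
  have hy : y ∈ S.V₁ ⊔ S.V₂ := by rw [S.isCompl.sup_eq_top]; trivial
  obtain ⟨x₁, hx₁, x₂, hx₂, rfl⟩ := Submodule.mem_sup.mp hx
  obtain ⟨y₁, hy₁, y₂, hy₂, rfl⟩ := Submodule.mem_sup.mp hy
  rw [lie_add, S.lie_mem_V₂ _ y₂ hy₂, add_zero, add_lie, ← lie_skew x₂ y₁,
    S.lie_mem_V₂ y₁ x₂ hx₂, neg_zero, add_zero, ← S.lie_V₁_V₁]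
  exact Submodule.subset_span ⟨x₁, hx₁, y₁, hy₁, rfl⟩

/-- Triple brackets vanish. -/
theorem lie_lie_eq_zero {𝔤 : Type*} [LieRing 𝔤] [LieAlgebra ℝ 𝔤] (S : TwoStepStratification 𝔤)
    (x y z : 𝔤) : ⁅x, ⁅y, z⁆⁆ = 0 :=
  S.lie_mem_V₂ x _ (S.lie_mem y z)

theorem lie_lie_eq_zero' {𝔤 : Type*} [LieRing 𝔤] [LieAlgebra ℝ 𝔤] (S : TwoStepStratification 𝔤)
    (x y z : 𝔤) : ⁅⁅x, y⁆, z⁆ = 0 := by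
  rw [← lie_skew, S.lie_lie_eq_zero, neg_zero]

/-- The two step stratified group with stratified Lie algebra `𝔤`: the connected, simply connected
Lie group with Lie algebra `𝔤`, realised on the space `𝔤` itself, with the
Baker-Campbell-Hausdorff product, through the exponential mapping `S.exp`. -/
def Grp (_S : TwoStepStratification 𝔤) : Type _ := 𝔤

/-- The exponential mapping `exp : 𝔤 → 𝔾`. -/
def exp : 𝔤 ≃ S.Grp := Equiv.refl 𝔤

/-- The group law `exp X · exp Y = exp (X + Y + ½ [X, Y])`
(in step two the Baker-Campbell-Hausdorff series ends here). -/
instance instGroupGrp : Group S.Grp where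
  mul x y := S.exp (S.exp.symm x + S.exp.symm y + (2⁻¹ : ℝ) • ⁅S.exp.symm x, S.exp.symm y⁆)
  one := S.exp 0
  inv x := S.exp (-S.exp.symm x)
  mul_assoc x y z := by
    change S.exp _ = S.exp _
    congr 1
    change (_ + _ + (2⁻¹ : ℝ) • ⁅_, _⁆ + S.exp.symm z
        + (2⁻¹ : ℝ) • ⁅(_ + _ + (2⁻¹ : ℝ) • ⁅_, _⁆ : 𝔤), _⁆)
      = (S.exp.symm x + (_ + _ + (2⁻¹ : ℝ) • ⁅_, _⁆)
        + (2⁻¹ : ℝ) • ⁅_, (_ + _ + (2⁻¹ : ℝ) • ⁅_, _⁆ : 𝔤)⁆)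
    simp only [add_lie, lie_add, smul_lie, lie_smul, S.lie_lie_eq_zero, S.lie_lie_eq_zero',
      smul_zero, add_zero, smul_add]
    abel
  one_mul x := by
    change S.exp ((0 : 𝔤) + S.exp.symm x + (2⁻¹ : ℝ) • ⁅(0 : 𝔤), S.exp.symm x⁆) = x
    rw [zero_lie, smul_zero, add_zero, zero_add, Equiv.apply_symm_apply]
  mul_one x := by
    change S.exp (S.exp.symm x + (0 : 𝔤) + (2⁻¹ : ℝ) • ⁅S.exp.symm x, (0 : 𝔤)⁆) = x
    rw [lie_zero, smul_zero, add_zero, add_zero, Equiv.apply_symm_apply]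
  inv_mul_cancel x := by
    change S.exp (-S.exp.symm x + S.exp.symm x + (2⁻¹ : ℝ) • ⁅-S.exp.symm x, S.exp.symm x⁆)
      = S.exp 0
    rw [neg_lie, lie_self, neg_zero, smul_zero, add_zero, neg_add_cancel]

theorem exp_mul_exp (X Y : 𝔤) :
    S.exp X * S.exp Y = S.exp (X + Y + (2⁻¹ : ℝ) • ⁅X, Y⁆) := rfl

/-- The dilation `δ_r (v₁ + v₂) = r v₁ + r² v₂` of the Lie algebra, where `v_j ∈ V_j`. -/
def algDilation (r : ℝ) (v : 𝔤) : 𝔤 :=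
  r • S.V₁.projection S.V₂ S.isCompl v
    + r ^ 2 • S.V₂.projection S.V₁ S.isCompl.symm v

/-- The dilation `δ_r` of the group, transported by the exponential mapping. -/
def dilation (r : ℝ) (x : S.Grp) : S.Grp := S.exp (S.algDilation r (S.exp.symm x))

/-- A graded basis of `𝔤`: a linear basis `W₁, …, W_q` each of whose vectors lies in one of the
two layers (the order of the vectors is immaterial). -/
structure GradedBasis (q : ℕ) where
  basis : Module.Basis (Fin q) ℝ 𝔤
  mem_layer : ∀ i, basis i ∈ S.V₁ ∨ basis i ∈ S.V₂

namespace GradedBasis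

variable {S} {q : ℕ} (W : S.GradedBasis q)

open Classical in
/-- The degree `d_i` of the `i`-th coordinate: `d_i = j` if `W_i ∈ V_j`. -/
def deg (i : Fin q) : ℕ := if W.basis i ∈ S.V₁ then 1 else 2

/-- The graded coordinates `F(y) = exp (∑ y_i W_i)`. They are a global chart that defines the
smooth structure and the topology of the group. -/
def coord : EuclideanSpace ℝ (Fin q) ≃ S.Grp :=
  ((EuclideanSpace.equiv (Fin q) ℝ).toEquiv.trans W.basis.equivFun.symm.toEquiv).trans S.exp

/-- The left translation `l_x` read in graded coordinates. -/
def leftTranslation (x : S.Grp) (y : EuclideanSpace ℝ (Fin q)) : EuclideanSpace ℝ (Fin q) :=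
  W.coord.symm (x * W.coord y)

/-- The value at `x`, read in graded coordinates, of the left invariant vector field that is
determined by `X ∈ 𝔤`: the differential of `l_x` at the unit element applied to `X`. -/
def leftInvariant (x : S.Grp) : 𝔤 →ₗ[ℝ] EuclideanSpace ℝ (Fin q) :=
  (fderiv ℝ (W.leftTranslation x) 0).toLinearMap ∘ₗ
    ((EuclideanSpace.equiv (Fin q) ℝ).symm.toLinearEquiv.toLinearMap ∘ₗ
      W.basis.equivFun.toLinearMap)

/-- `Sig` is a `p`-dimensional `C^{1,1}` (embedded) submanifold of the group: near each of its
points it is, in graded coordinates, the zero set of a `C¹` mapping `f` into `ℝ^(q-p)` whose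
differential is Lipschitz continuous and, on the zero set, surjective. -/
def IsC11Submanifold (p : ℕ) (Sig : Set S.Grp) : Prop :=
  p ≤ q ∧ ∀ x ∈ Sig, ∃ (U : Set (EuclideanSpace ℝ (Fin q)))
    (f : EuclideanSpace ℝ (Fin q) → EuclideanSpace ℝ (Fin (q - p))) (K : ℝ≥0),
    IsOpen U ∧ W.coord.symm x ∈ U ∧ ContDiffOn ℝ 1 f U ∧ LipschitzOnWith K (fderiv ℝ f) U ∧
    (∀ y ∈ U, f y = 0 → Function.Surjective (fderiv ℝ f y)) ∧
    (∀ y ∈ U, W.coord y ∈ Sig ↔ f y = 0)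

/-- The tangent space `T_x Sig` read in graded coordinates, spanned by the velocities at `x` of
curves in `Sig`. -/
def tangentSpace (Sig : Set S.Grp) (x : S.Grp) : Submodule ℝ (EuclideanSpace ℝ (Fin q)) :=
  Submodule.span ℝ {v | ∃ γ : ℝ → EuclideanSpace ℝ (Fin q),
    γ 0 = W.coord.symm x ∧ (∀ᶠ t in 𝓝 0, W.coord (γ t) ∈ Sig) ∧ HasDerivAt γ v 0}

/-- The tangent space `T_x Sig` as a subspace of `𝔤`, under the identification of `𝔤` with the
tangent space of the group at `x` by left invariant vector fields. -/
def tangentAlg (Sig : Set S.Grp) (x : S.Grp) : Submodule ℝ 𝔤 :=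
  (W.tangentSpace Sig x).comap (W.leftInvariant x)

/-- The degree of a `p`-vector `τ = ∑_J τ_J W_J`: the maximum of
`d_J = ∑_{j ∈ J} d_j` over the `J` with `τ_J ≠ 0`. -/
def pVectorDegree {p : ℕ} (τ : ⋀[ℝ]^p 𝔤) : ℕ :=
  sSup {m | ∃ J : Set.powersetCard (Fin q) p,
    (W.basis.exteriorPower p).repr τ J ≠ 0 ∧ m = ∑ j ∈ (J : Finset (Fin q)), W.deg j}

/-- `τ` is a tangent `p`-vector of `Sig` at `x`: the wedge product of a basis of `T_x Sig`. -/
def IsTangentPVector {p : ℕ} (Sig : Set S.Grp) (x : S.Grp) (τ : ⋀[ℝ]^p 𝔤) : Prop :=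
  ∃ v : Fin p → 𝔤, LinearIndependent ℝ v ∧ Submodule.span ℝ (Set.range v) = W.tangentAlg Sig x ∧
    τ = exteriorPower.ιMulti ℝ p v

/-- The pointwise degree `d_Sig(x)` of a `p`-dimensional submanifold `Sig` at `x`: the degree of
a tangent `p`-vector of `Sig` at `x`. (All of them are proportional, so the supremum is over
one number.) -/
def pointDegree (p : ℕ) (Sig : Set S.Grp) (x : S.Grp) : ℕ :=
  sSup {m | ∃ τ : ⋀[ℝ]^p 𝔤, W.IsTangentPVector Sig x τ ∧ m = W.pVectorDegree τ}

/-- A homogeneous distance: a distance on the group that is continuous (in graded coordinates),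
left invariant, and homogeneous with respect to the dilations. -/
structure HomogeneousDistance where
  ρ : S.Grp → S.Grp → ℝ
  eq_zero_iff : ∀ x y, ρ x y = 0 ↔ x = y
  symm : ∀ x y, ρ x y = ρ y x
  triangle : ∀ x y z, ρ x z ≤ ρ x y + ρ y z
  continuous : Continuous fun y : EuclideanSpace ℝ (Fin q) × EuclideanSpace ℝ (Fin q) =>
    ρ (W.coord y.1) (W.coord y.2)
  left_invariant : ∀ u x y, ρ (u * x) (u * y) = ρ x y
  homogeneous : ∀ r : ℝ, 0 < r → ∀ x y, ρ (S.dilation r x) (S.dilation r y) = r * ρ x y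

namespace HomogeneousDistance

variable {W} (D : W.HomogeneousDistance)

/-- The group as a metric space with a given homogeneous distance. -/
abbrev metricSpace : MetricSpace S.Grp where
  dist := D.ρ
  dist_self x := (D.eq_zero_iff x x).mpr rfl
  dist_comm := D.symm
  dist_triangle := D.triangle
  eq_of_dist_eq_zero {x y} h := (D.eq_zero_iff x y).mp h

/-- The `s`-dimensional Hausdorff measure `H^s` constructed with the homogeneous distance. -/
def hausdorff (s : ℝ) (A : Set S.Grp) : ℝ≥0∞ :=
  letI : MetricSpace S.Grp := D.metricSpace
  letI : MeasurableSpace S.Grp := borel S.Grp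
  haveI : BorelSpace S.Grp := ⟨rfl⟩
  μH[s] A

/-- The Hausdorff dimension with respect to the homogeneous distance. -/
def hausdorffDim (A : Set S.Grp) : ℝ≥0∞ :=
  letI : MetricSpace S.Grp := D.metricSpace
  dimH A

/-- `A` is countably `H^s`-finite: it is a countable union of sets of finite `H^s` measure. -/
def CountablyFinite (s : ℝ) (A : Set S.Grp) : Prop :=
  ∃ B : ℕ → Set S.Grp, A = ⋃ n, B n ∧ ∀ n, D.hausdorff s (B n) < ∞

end HomogeneousDistance

end GradedBasis

end TwoStepStratification

end

/-! Near a point, parametrize Σ by Φ on a bounded open subset of ℝ^p. The claim reduces to one lower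
bound: if x = Φ(k) has degree at most δ, the parameter set of the ball of radius r about x has
Lebesgue measure at least c r^δ for small r (`exists_measure_ball_ge`).

By continuity and homogeneity the ball contains all y such that the i-th graded coordinate of x⁻¹y
is below c₀ r^(d_i). In step two, left translations are affine in graded coordinates, so for y =
Φ(k+h) these coordinates are ℓ_i(h) + O(|h|²), where the ℓ_i are the coordinate forms on the tangent
space in the left invariant frame; the quadratic error comes from C^{1,1} regularity. Choose p of
the ℓ_i forming a basis of the dual space, taking as many of weight 2 as possible. The corresponding
minor of the tangent p-vector is nonzero, so the weights of the chosen forms sum to at most δ. On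
the box where each chosen form is at most (ar)^(d_j), with a a small constant, every ℓ_i is
O((ar)^(d_i)), and the quadratic error is O((ar)²), which is harmless because no weight exceeds 2.
The box has measure comparable to r raised to the sum of the weights, which is at least a constant
times r^δ.

The constants depend on x, so the set is split into countably many pieces on which they are uniform.
On each piece, disjoint balls of radius r number at most a constant times r^(-δ), and doubling a
maximal disjoint family gives covers that bound the Hausdorff measure
(`hausdorffMeasure_lt_top_of_forall_le_measure`). Countably many charts suffice by the Lindelöf
property. -/

noncomputable section

/-! ### Left translations, dilations and balls in graded coordinates. -/

namespace TwoStepStratification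

variable {𝔤 : Type*} [LieRing 𝔤] [LieAlgebra ℝ 𝔤] {S : TwoStepStratification 𝔤}

namespace GradedBasis

variable {q : ℕ} (W : S.GradedBasis q)

/-- Graded coordinates on the Lie algebra. -/
def algCoord : 𝔤 ≃ₗ[ℝ] EuclideanSpace ℝ (Fin q) :=
  W.basis.equivFun.trans (EuclideanSpace.equiv (Fin q) ℝ).symm.toLinearEquiv

theorem coord_apply (y : EuclideanSpace ℝ (Fin q)) :
    W.coord y = S.exp (W.algCoord.symm y) := rfl

theorem coord_symm_apply (x : S.Grp) :
    W.coord.symm x = W.algCoord (S.exp.symm x) := rfl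

/-- The linear part `X ↦ X + ½ [Z, X]` of a left translation. -/
def translationLinear (Z : 𝔤) : 𝔤 ≃ₗ[ℝ] 𝔤 where
  toFun X := X + (2⁻¹ : ℝ) • ⁅Z, X⁆
  -- In step two, ad Z squares to zero, so 1 − ½ ad Z inverts 1 + ½ ad Z.
  invFun X := X - (2⁻¹ : ℝ) • ⁅Z, X⁆
  map_add' X Y := by rw [lie_add, smul_add]; abel
  map_smul' c X := by rw [lie_smul, RingHom.id_apply, smul_add, smul_comm]
  left_inv X := by
    simp only [lie_add, lie_smul, S.lie_lie_eq_zero, smul_zero, add_zero, add_sub_cancel_right]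
  right_inv X := by
    simp only [lie_sub, lie_smul, S.lie_lie_eq_zero, smul_zero, sub_zero, sub_add_cancel]

/-- The left invariant frame at `x`, as a linear isomorphism. -/
def leftInvariantEquiv (x : S.Grp) : 𝔤 ≃ₗ[ℝ] EuclideanSpace ℝ (Fin q) :=
  (translationLinear (S := S) (S.exp.symm x)).trans W.algCoord

/-- The product is affine in its second factor, so a left translation coincides with its first order
expansion at the unit. -/
theorem leftTranslation_apply (x : S.Grp) (y : EuclideanSpace ℝ (Fin q)) :
    W.leftTranslation x y =
      W.coord.symm x + W.leftInvariantEquiv x (W.algCoord.symm y) := by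
  have h : W.leftTranslation x y = W.algCoord (S.exp.symm x + W.algCoord.symm y
      + (2⁻¹ : ℝ) • ⁅S.exp.symm x, W.algCoord.symm y⁆) := rfl
  rw [h, coord_symm_apply, add_assoc, map_add]
  rfl

theorem leftInvariant_eq (x : S.Grp) :
    W.leftInvariant x = (W.leftInvariantEquiv x).toLinearMap := by
  have hd : fderiv ℝ (W.leftTranslation x) 0 =
      LinearMap.toContinuousLinearMap
        ((W.algCoord.symm.trans (W.leftInvariantEquiv x)).toLinearMap) := by
    have he : W.leftTranslation x = fun y => W.coord.symm x + LinearMap.toContinuousLinearMap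
        ((W.algCoord.symm.trans (W.leftInvariantEquiv x)).toLinearMap) y :=
      funext fun y => W.leftTranslation_apply x y
    rw [he, fderiv_const_add, ContinuousLinearMap.fderiv]
  ext X : 1
  have h : W.leftInvariant x X = fderiv ℝ (W.leftTranslation x) 0 (W.algCoord X) := rfl
  rw [h, hd]
  simp

/-- There is no remainder: the frame at x that identifies tangent vectors with `𝔤` also computes
x⁻¹y exactly. This links distances from x to the tangent space at x. -/
theorem inv_mul_coord (x : S.Grp) (y : EuclideanSpace ℝ (Fin q)) :
    x⁻¹ * W.coord y =
      S.exp ((W.leftInvariantEquiv x).symm (y - W.coord.symm x)) := by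
  have h : W.coord y = x * S.exp ((W.leftInvariantEquiv x).symm (y - W.coord.symm x)) := by
    have h1 := W.leftTranslation_apply x
      (W.algCoord ((W.leftInvariantEquiv x).symm (y - W.coord.symm x)))
    rw [LinearEquiv.symm_apply_apply, LinearEquiv.apply_symm_apply, add_sub_cancel] at h1
    have h2 := congrArg W.coord h1
    rw [leftTranslation, Equiv.apply_symm_apply] at h2
    rw [← h2, coord_apply, LinearEquiv.symm_apply_apply]
  rw [h, inv_mul_cancel_left]

theorem deg_eq_one_or_two (i : Fin q) : W.deg i = 1 ∨ W.deg i = 2 := by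
  unfold deg
  split_ifs <;> simp

theorem basis_repr_algDilation (r : ℝ) (v : 𝔤) (i : Fin q) :
    W.basis.repr (S.algDilation r v) i = r ^ W.deg i * W.basis.repr v i := by
  let A : 𝔤 →ₗ[ℝ] 𝔤 := r • S.V₁.projection S.V₂ S.isCompl
    + r ^ 2 • S.V₂.projection S.V₁ S.isCompl.symm
  have hA : ∀ v, S.algDilation r v = A v := fun v => rfl
  have hW : ∀ j, A (W.basis j) = r ^ W.deg j • W.basis j := by
    intro j
    rw [← hA, algDilation, deg]
    split_ifs with h
    · rw [Submodule.projection_apply_of_mem_left _ h,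
        Submodule.projection_apply_of_mem_right _ h, smul_zero, add_zero, pow_one]
    · have h2 := (W.mem_layer j).resolve_left h
      rw [Submodule.projection_apply_of_mem_right _ h2,
        Submodule.projection_apply_of_mem_left _ h2, smul_zero, zero_add]
  have hl : (W.basis.coord i).comp A = r ^ W.deg i • W.basis.coord i := by
    refine W.basis.ext fun j => ?_
    rw [LinearMap.comp_apply, hW, map_smul, LinearMap.smul_apply, Module.Basis.coord_apply,
      Module.Basis.repr_self]
    by_cases h : j = i
    · rw [h]
    · rw [Finsupp.single_eq_of_ne (Ne.symm h), smul_zero, smul_zero]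
  have := LinearMap.congr_fun hl v
  rw [hA]
  simpa using this

theorem exp_zero : S.exp 0 = 1 := rfl

namespace HomogeneousDistance

variable {W} (D : W.HomogeneousDistance)

/-- Continuity puts a coordinate cube inside the unit ball, and dilations carry the inclusion to
every scale. The reverse inclusion is not needed. -/
theorem exists_lt_of_coords_lt : ∃ c : ℝ, 0 < c ∧ ∀ r : ℝ, 0 < r → ∀ v : 𝔤,
    (∀ i, |W.basis.repr v i| < c * r ^ W.deg i) → D.ρ 1 (S.exp v) < r := by
  have hc : Continuous fun y : Fin q → ℝ =>
      D.ρ (W.coord 0) (W.coord (WithLp.toLp 2 y)) := by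
    have h : Continuous fun y : Fin q → ℝ =>
        ((0 : EuclideanSpace ℝ (Fin q)), (WithLp.toLp 2 y : EuclideanSpace ℝ (Fin q))) :=
      continuous_const.prodMk (PiLp.continuous_toLp 2 _)
    have h2 := D.continuous.comp h
    simp only [Function.comp_def] at h2
    exact h2
  have h0 : W.coord 0 = 1 := by rw [coord_apply, map_zero, exp_zero]
  have hopen : {y : Fin q → ℝ | D.ρ (W.coord 0) (W.coord (WithLp.toLp 2 y)) < 1} ∈
      𝓝 (0 : Fin q → ℝ) := by
    refine (isOpen_lt hc continuous_const).mem_nhds ?_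
    change D.ρ (W.coord 0) (W.coord 0) < 1
    rw [(D.eq_zero_iff _ _).mpr rfl]
    exact one_pos
  obtain ⟨c, hc0, hball⟩ := Metric.mem_nhds_iff.mp hopen
  refine ⟨c, hc0, fun r hr v hv => ?_⟩
  have hw : ∀ i, W.basis.repr (S.algDilation r⁻¹ v) i = W.basis.repr v i / r ^ W.deg i := by
    intro i
    rw [basis_repr_algDilation, inv_pow, inv_mul_eq_div]
  have hmem : (fun i => W.basis.repr (S.algDilation r⁻¹ v) i) ∈ Metric.ball (0 : Fin q → ℝ) c := by
    rw [mem_ball_zero_iff, pi_norm_lt_iff hc0]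
    intro i
    rw [hw, Real.norm_eq_abs, abs_div, abs_of_pos (pow_pos hr _), div_lt_iff₀ (pow_pos hr _)]
    exact hv i
  have h1 : D.ρ (W.coord 0) (S.exp (S.algDilation r⁻¹ v)) < 1 := by
    have := hball hmem
    have he : W.coord (WithLp.toLp 2 fun i => W.basis.repr (S.algDilation r⁻¹ v) i) =
        S.exp (S.algDilation r⁻¹ v) := by
      rw [coord_apply]
      congr 1
      rw [LinearEquiv.symm_apply_eq]
      rfl
    rwa [mem_ofPred_eq, he] at this
  have hd1 : S.dilation r 1 = 1 := by
    change S.exp (S.algDilation r 0) = S.exp 0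
    simp [algDilation]
  have hd2 : S.dilation r (S.exp (S.algDilation r⁻¹ v)) = S.exp v := by
    change S.exp (S.algDilation r (S.algDilation r⁻¹ v)) = S.exp v
    congr 1
    apply W.basis.repr.injective
    ext i
    rw [basis_repr_algDilation, hw, mul_div_cancel₀ _ (pow_pos hr _).ne']
  have h2 := D.homogeneous r hr 1 (S.exp (S.algDilation r⁻¹ v))
  rw [hd1, hd2] at h2
  rw [h2]
  rw [h0] at h1
  nlinarith

end HomogeneousDistance

end GradedBasis

end TwoStepStratification

/-! ### From lower bounds on measures of balls to finite Hausdorff measure. -/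

section Packing

variable {X N : Type*} [MetricSpace X] [MeasurableSpace N] {μ : Measure N} {Ω : Set N} {Φ : N → X}
  {A : Set X}

theorem card_mul_le_measure_of_pairwiseDisjoint_balls {r : ℝ} {m : ℝ≥0∞}
    (hmeas : ∀ x ∈ A, MeasurableSet (Ω ∩ Φ ⁻¹' Metric.ball x r))
    (hlow : ∀ x ∈ A, m ≤ μ (Ω ∩ Φ ⁻¹' Metric.ball x r)) {F : Finset X} (hF : ↑F ⊆ A)
    (hdisj : (F : Set X).PairwiseDisjoint fun x => Metric.ball x r) :
    F.card * m ≤ μ Ω := by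
  calc (F.card : ℝ≥0∞) * m = ∑ _x ∈ F, m := by rw [Finset.sum_const, nsmul_eq_mul]
    _ ≤ ∑ x ∈ F, μ (Ω ∩ Φ ⁻¹' Metric.ball x r) := Finset.sum_le_sum fun x hx => hlow x (hF hx)
    _ = μ (⋃ x ∈ F, Ω ∩ Φ ⁻¹' Metric.ball x r) := by
      refine (measure_biUnion_finset ?_ fun x hx => hmeas x (hF hx)).symm
      intro x hx y hy hxy
      exact ((hdisj hx hy hxy).preimage Φ).mono inter_subset_right inter_subset_right
    _ ≤ μ Ω := measure_mono (iUnion₂_subset fun x _ => inter_subset_left)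

/-- The measure bounds the size of a disjoint family of r-balls centred in `A`, so one of maximal
cardinality exists. By maximality no point of `A` is at distance 2r or more from all its centres. -/
theorem exists_finset_cover_of_measure_balls {r : ℝ} {m : ℝ≥0∞} (hm : m ≠ 0) (hm' : m ≠ ∞)
    (hr : 0 < r) (hΩ : μ Ω ≠ ∞)
    (hmeas : ∀ x ∈ A, MeasurableSet (Ω ∩ Φ ⁻¹' Metric.ball x r))
    (hlow : ∀ x ∈ A, m ≤ μ (Ω ∩ Φ ⁻¹' Metric.ball x r)) :
    ∃ F : Finset X, F.card * m ≤ μ Ω ∧ A ⊆ ⋃ x ∈ F, Metric.ball x (2 * r) := by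
  classical
  let T : Set ℕ := {n | ∃ F : Finset X, ↑F ⊆ A ∧
    ((F : Set X).PairwiseDisjoint fun x => Metric.ball x r) ∧ F.card = n}
  have hbdd : BddAbove T := by
    obtain ⟨M, hM⟩ := ENNReal.exists_nat_gt (ENNReal.div_ne_top hΩ hm)
    refine ⟨M, ?_⟩
    rintro n ⟨F, hFA, hFd, rfl⟩
    have h := card_mul_le_measure_of_pairwiseDisjoint_balls hmeas hlow hFA hFd
    have h' : (F.card : ℝ≥0∞) ≤ μ Ω / m := (ENNReal.le_div_iff_mul_le (.inl hm) (.inl hm')).mpr h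
    exact_mod_cast (h'.trans_lt hM).le
  obtain ⟨F, hFA, hFd, hFc⟩ := Nat.sSup_mem (s := T) ⟨0, ∅, by simp, by simp, rfl⟩ hbdd
  refine ⟨F, card_mul_le_measure_of_pairwiseDisjoint_balls hmeas hlow hFA hFd, fun x hx => ?_⟩
  by_contra hcon
  simp only [mem_iUnion, Metric.mem_ball, not_exists, not_lt] at hcon
  have hxF : x ∉ F := fun h => by
    have := hcon x h
    rw [dist_self] at this
    linarith
  have hmem : F.card + 1 ∈ T := by
    refine ⟨insert x F, ?_, ?_, Finset.card_insert_of_notMem hxF⟩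
    · rw [Finset.coe_insert]
      exact insert_subset hx hFA
    · rw [Finset.coe_insert]
      refine hFd.insert fun y hy _ => ?_
      exact Metric.ball_disjoint_ball (by linarith [hcon y hy])
  have := le_csSup hbdd hmem
  omega

/-- A lower bound on the growth of the measures of small balls implies finiteness of
the Hausdorff measure. -/
theorem hausdorffMeasure_lt_top_of_forall_le_measure [MeasurableSpace X] [BorelSpace X]
    {d c r₀ : ℝ} (hd : 0 ≤ d) (hc : 0 < c) (hr₀ : 0 < r₀) (hΩ : μ Ω ≠ ∞)
    (hmeas : ∀ x ∈ A, ∀ r, MeasurableSet (Ω ∩ Φ ⁻¹' Metric.ball x r))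
    (hlow : ∀ x ∈ A, ∀ r, 0 < r → r < r₀ →
      ENNReal.ofReal (c * r ^ d) ≤ μ (Ω ∩ Φ ⁻¹' Metric.ball x r)) :
    μH[d] A < ∞ := by
  -- With n + 2 in the denominator the radii are strictly below `r₀` already at n = 0.
  have hρ : ∀ n : ℕ, 0 < r₀ / (n + 2) ∧ r₀ / (n + 2) < r₀ := fun n =>
    ⟨by positivity, div_lt_self hr₀ (by linarith [(Nat.cast_nonneg n : (0 : ℝ) ≤ n)])⟩
  have hex : ∀ n : ℕ, ∃ F : Finset X, F.card * ENNReal.ofReal (c * (r₀ / (n + 2)) ^ d) ≤ μ Ω ∧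
      A ⊆ ⋃ x ∈ F, Metric.ball x (2 * (r₀ / (n + 2))) := by
    intro n
    have hpos := (hρ n).1
    refine exists_finset_cover_of_measure_balls ?_ ENNReal.ofReal_ne_top hpos hΩ
      (fun x hx => hmeas x hx _) fun x hx => hlow x hx _ (hρ n).1 (hρ n).2
    exact (ENNReal.ofReal_pos.mpr (by positivity)).ne'
  choose F hFcard hFcov using hex
  have hdiam : ∀ (n : ℕ) (x : X), Metric.ediam (Metric.ball x (2 * (r₀ / (n + 2)))) ≤
      ENNReal.ofReal (4 * (r₀ / (n + 2))) := by
    intro n x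
    refine Metric.ediam_le_of_forall_dist_le fun y hy z hz => ?_
    have := dist_triangle_right y z x
    rw [Metric.mem_ball] at hy hz
    linarith
  have hlim : Tendsto (fun n : ℕ => ENNReal.ofReal (4 * (r₀ / (n + 2)))) atTop (𝓝 0) := by
    rw [← ENNReal.ofReal_zero]
    refine ENNReal.tendsto_ofReal ?_
    have h1 : Tendsto (fun n : ℕ => (n : ℝ) + 2) atTop atTop :=
      tendsto_atTop_add_const_right _ _ tendsto_natCast_atTop_atTop
    simpa using (h1.const_div_atTop r₀).const_mul 4
  have key := Measure.hausdorffMeasure_le_liminf_sum d A _ hlim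
    (fun (n : ℕ) (x : F n) => Metric.ball (x : X) (2 * (r₀ / (n + 2))))
    (Eventually.of_forall fun n x => hdiam n x)
    (Eventually.of_forall fun n => by
      rw [iUnion_subtype]
      exact hFcov n)
  -- Doubled balls have diameter at most 4ρ, and (4ρ)^d = (4^d / c) · cρ^d, where the cardinality
  -- times cρ^d is at most μ Ω.
  refine (key.trans (liminf_le_of_frequently_le' (x := ENNReal.ofReal (4 ^ d / c) * μ Ω)
    (Frequently.of_forall fun n => ?_))).trans_lt (ENNReal.mul_lt_top ENNReal.ofReal_lt_top hΩ.lt_top)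
  have hpos := (hρ n).1
  calc ∑ x : F n, Metric.ediam (Metric.ball (x : X) (2 * (r₀ / (n + 2)))) ^ d
      ≤ ∑ _x : F n, ENNReal.ofReal (4 * (r₀ / (n + 2))) ^ d :=
        Finset.sum_le_sum fun x _ => ENNReal.rpow_le_rpow (hdiam n x) hd
    _ = (F n).card * ENNReal.ofReal (4 * (r₀ / (n + 2))) ^ d := by
        rw [Finset.sum_const, nsmul_eq_mul, Finset.card_univ, Fintype.card_coe]
    _ = ENNReal.ofReal (4 ^ d / c) * ((F n).card * ENNReal.ofReal (c * (r₀ / (n + 2)) ^ d)) := by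
        rw [mul_left_comm, ← ENNReal.ofReal_mul (by positivity),
          ENNReal.ofReal_rpow_of_pos (by positivity), Real.mul_rpow (by norm_num) hpos.le]
        congr 2
        field_simp
    _ ≤ ENNReal.ofReal (4 ^ d / c) * μ Ω := by gcongr; exact hFcard n

end Packing

/-! ### Bases of linear forms adapted to the weights. -/

section LinearAlgebra

variable {N : Type*} [AddCommGroup N] [Module ℝ N] {ι : Type*}

/-- From a separating family of linear forms one can extract a basis of the dual space, compatible
with a given subfamily. -/
theorem exists_finset_linearForms_basis [Finite ι] [FiniteDimensional ℝ N]
    (ℓ : ι → Module.Dual ℝ N)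
    (hsep : ∀ h, (∀ i, ℓ i h = 0) → h = 0) (t : Set ι) :
    ∃ b : Finset ι, b.card = Module.finrank ℝ N ∧ (∀ i, ℓ i ∈ Submodule.span ℝ (ℓ '' b)) ∧
      (∀ i ∈ t, ℓ i ∈ Submodule.span ℝ (ℓ '' (b ∩ t))) ∧
      ∀ h, (∀ j ∈ b, ℓ j h = 0) → h = 0 := by
  classical
  -- Exhausting `t` before enlarging to all indices makes the part of the basis inside `t` span
  -- every form indexed by `t`.
  obtain ⟨s, hst, -, hs, hsl⟩ :=
    exists_linearIndepOn_extension (linearIndepOn_empty ℝ ℓ) (empty_subset t)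
  obtain ⟨b, -, hsb, hb, hbl⟩ := exists_linearIndepOn_extension hsl (subset_univ s)
  have hbs : ∀ i, ℓ i ∈ Submodule.span ℝ (ℓ '' b) := fun i => hb ⟨i, mem_univ i, rfl⟩
  have hinj : ∀ h, (∀ j ∈ b, ℓ j h = 0) → h = 0 := by
    intro h hh
    refine hsep h fun i => ?_
    have hle : Submodule.span ℝ (ℓ '' b) ≤ LinearMap.ker (Module.Dual.eval ℝ N h) := by
      rw [Submodule.span_le]
      rintro _ ⟨j, hj, rfl⟩
      exact hh j hj
    exact hle (hbs i)
  have hfin : b.Finite := toFinite b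
  refine ⟨hfin.toFinset, le_antisymm ?_ ?_, ?_, ?_, ?_⟩
  · have h1 : LinearIndependent ℝ fun j : hfin.toFinset => ℓ j := by
      have : LinearIndepOn ℝ ℓ (hfin.toFinset : Set ι) := by rwa [hfin.coe_toFinset]
      exact this
    simpa [Subspace.dual_finrank_eq] using h1.fintype_card_le_finrank
  · let M : N →ₗ[ℝ] (hfin.toFinset → ℝ) := LinearMap.pi fun j => ℓ j
    have hM : Function.Injective M := by
      rw [← LinearMap.ker_eq_bot, LinearMap.ker_eq_bot']
      intro h hh
      exact hinj h fun j hj => congrFun hh ⟨j, hfin.mem_toFinset.mpr hj⟩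
    simpa using LinearMap.finrank_le_finrank_of_injective hM
  · rwa [hfin.coe_toFinset]
  · intro i hi
    rw [hfin.coe_toFinset]
    exact Submodule.span_mono (image_mono (subset_inter hsb hst)) (hs ⟨i, hi, rfl⟩)
  · intro h hh
    exact hinj h fun j hj => hh j (hfin.mem_toFinset.mpr hj)

/-- The constant does not depend on `ε`, so the bound may be used with ε of order r and of order r².
-/
theorem exists_abs_le_of_mem_span {ℓ : ι → Module.Dual ℝ N} {s : Set ι} {φ : Module.Dual ℝ N}
    (hφ : φ ∈ Submodule.span ℝ (ℓ '' s)) :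
    ∃ C : ℝ, 0 ≤ C ∧ ∀ (h : N) (ε : ℝ), 0 ≤ ε → (∀ j ∈ s, |ℓ j h| ≤ ε) → |φ h| ≤ C * ε := by
  induction hφ using Submodule.span_induction with
  | mem φ hφ =>
    obtain ⟨j, hj, rfl⟩ := hφ
    exact ⟨1, zero_le_one, fun h ε _ hh => by rw [one_mul]; exact hh j hj⟩
  | zero => exact ⟨0, le_rfl, fun h ε _ _ => by simp⟩
  | add φ ψ _ _ h1 h2 =>
    obtain ⟨C1, h10, h1⟩ := h1
    obtain ⟨C2, h20, h2⟩ := h2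
    refine ⟨C1 + C2, add_nonneg h10 h20, fun h ε hε hh => ?_⟩
    rw [LinearMap.add_apply, add_mul]
    exact (abs_add_le _ _).trans (add_le_add (h1 h ε hε hh) (h2 h ε hε hh))
  | smul a φ _ h1 =>
    obtain ⟨C1, h10, h1⟩ := h1
    refine ⟨|a| * C1, by positivity, fun h ε hε hh => ?_⟩
    rw [LinearMap.smul_apply, smul_eq_mul, abs_mul, mul_assoc]
    exact mul_le_mul_of_nonneg_left (h1 h ε hε hh) (abs_nonneg a)

end LinearAlgebra

/-! ### The pointwise degree and minors of the tangent p-vector. -/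

namespace TwoStepStratification

variable {𝔤 : Type*} [LieRing 𝔤] [LieAlgebra ℝ 𝔤] {S : TwoStepStratification 𝔤}

namespace GradedBasis

variable {q : ℕ} (W : S.GradedBasis q)

/-- The coefficient is the determinant of the `J`-coordinates of the vectors `v i`. If it vanished,
some nontrivial combination of them would have zero `J`-coordinates. -/
theorem exteriorPower_repr_ιMulti_ne_zero {p : ℕ} {v : Fin p → 𝔤} (hv : LinearIndependent ℝ v)
    (J : Set.powersetCard (Fin q) p)
    (hJ : ∀ X ∈ Submodule.span ℝ (range v),
      (∀ j ∈ (J : Finset (Fin q)), W.basis.repr X j = 0) → X = 0) :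
    (W.basis.exteriorPower p).repr (exteriorPower.ιMulti ℝ p v) J ≠ 0 := by
  rw [exteriorPower.basis_repr_apply, exteriorPower.ιMultiDual_apply_ιMulti]
  intro hdet
  obtain ⟨c, hc, hcM⟩ := Matrix.exists_vecMul_eq_zero_iff.mpr hdet
  have hX : ∑ i, c i • v i = 0 := by
    refine hJ _ (Submodule.sum_mem _ fun i _ =>
      Submodule.smul_mem _ _ (Submodule.subset_span ⟨i, rfl⟩)) fun j hj => ?_
    obtain ⟨k, rfl⟩ := (Set.powersetCard.mem_range_ofFinEmbEquiv_symm_iff_mem J j).mpr hj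
    have := congrFun hcM k
    simpa [Matrix.vecMul, dotProduct] using this
  exact hc (funext fun i => Fintype.linearIndependent_iff.mp hv c hX i)

theorem sum_deg_le (J : Finset (Fin q)) : ∑ j ∈ J, W.deg j ≤ J.card * 2 := by
  rw [← smul_eq_mul]
  refine Finset.sum_le_card_nsmul _ _ _ fun j _ => ?_
  rcases W.deg_eq_one_or_two j with h | h <;> omega

/-- An unbounded set of naturals has `sSup` equal to 0, so a bound is required before elements can
be compared with the supremum. -/
theorem pVectorDegree_set_bound {p : ℕ} (τ : ⋀[ℝ]^p 𝔤) :
    p * 2 ∈ upperBounds {m | ∃ J : Set.powersetCard (Fin q) p,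
      (W.basis.exteriorPower p).repr τ J ≠ 0 ∧ m = ∑ j ∈ (J : Finset (Fin q)), W.deg j} := by
  rintro m ⟨J, -, rfl⟩
  have := W.sum_deg_le (J : Finset (Fin q))
  rwa [J.2] at this

theorem pVectorDegree_le {p : ℕ} (τ : ⋀[ℝ]^p 𝔤) : W.pVectorDegree τ ≤ p * 2 :=
  csSup_le' (W.pVectorDegree_set_bound τ)

theorem pVectorDegree_le_pointDegree {p : ℕ} {Sig : Set S.Grp} {x : S.Grp} {τ : ⋀[ℝ]^p 𝔤}
    (h : W.IsTangentPVector Sig x τ) : W.pVectorDegree τ ≤ W.pointDegree p Sig x := by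
  refine le_csSup ⟨p * 2, ?_⟩ ⟨τ, h, rfl⟩
  rintro m ⟨τ', -, rfl⟩
  exact W.pVectorDegree_le τ'

/-- A set of `p` coordinates that are linearly independent on the tangent space bounds
the pointwise degree from below. -/
theorem sum_deg_le_pointDegree {p : ℕ} {Sig : Set S.Grp} {x : S.Grp}
    (hp : Module.finrank ℝ (W.tangentAlg Sig x) = p) {b : Finset (Fin q)} (hb : b.card = p)
    (hbx : ∀ X ∈ W.tangentAlg Sig x, (∀ j ∈ b, W.basis.repr X j = 0) → X = 0) :
    ∑ j ∈ b, W.deg j ≤ W.pointDegree p Sig x := by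
  have : FiniteDimensional ℝ 𝔤 := W.basis.finiteDimensional_of_finite
  let B := Module.finBasisOfFinrankEq ℝ (W.tangentAlg Sig x) hp
  let v : Fin p → 𝔤 := fun i => B i
  have hv : LinearIndependent ℝ v :=
    B.linearIndependent.map' (Submodule.subtype _) (Submodule.ker_subtype _)
  have hspan : Submodule.span ℝ (range v) = W.tangentAlg Sig x := by
    have h1 : range v = (Submodule.subtype (W.tangentAlg Sig x)) '' range B := by
      rw [← range_comp]
      rfl
    rw [h1, Submodule.span_image, B.span_eq, Submodule.map_top, Submodule.range_subtype]
  have hτ : W.IsTangentPVector Sig x (exteriorPower.ιMulti ℝ p v) := ⟨v, hv, hspan, rfl⟩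
  refine le_trans ?_ (W.pVectorDegree_le_pointDegree hτ)
  refine le_csSup ⟨p * 2, W.pVectorDegree_set_bound _⟩ ⟨⟨b, hb⟩, ?_, rfl⟩
  exact W.exteriorPower_repr_ιMulti_ne_zero hv ⟨b, hb⟩ fun X hX hj => hbx X (hspan ▸ hX) hj

end GradedBasis

end TwoStepStratification

/-! ### Measure of anisotropic boxes and of their perturbations. -/

section Boxes

variable {N : Type*} [NormedAddCommGroup N] [NormedSpace ℝ N]
  [MeasurableSpace N] [BorelSpace N] (μ : Measure N) [μ.IsAddHaarMeasure]

/-- The image of μ under `e` is a positive multiple of Lebesgue measure; the sides 2r^(d j) are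
bounded below by r^(d j). -/
theorem exists_measure_anisotropic_box_ge {ι : Type*} [Fintype ι] (e : N ≃L[ℝ] (ι → ℝ))
    (d : ι → ℕ) : ∃ c : ℝ, 0 < c ∧ ∀ r : ℝ, 0 < r →
      ENNReal.ofReal (c * r ^ ∑ j, d j) ≤ μ {h | ∀ j, |e h j| < r ^ d j} := by
  have hmap : μ.map e = Measure.addHaarScalarFactor (μ.map e) volume • (volume : Measure (ι → ℝ)) :=
    Measure.isAddLeftInvariant_eq_smul _ _
  have hκ : 0 < Measure.addHaarScalarFactor (μ.map e) (volume : Measure (ι → ℝ)) :=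
    Measure.addHaarScalarFactor_pos_of_isAddHaarMeasure _ _
  set κ := Measure.addHaarScalarFactor (μ.map e) (volume : Measure (ι → ℝ))
  refine ⟨κ, hκ, fun r hr => ?_⟩
  have hset : {h | ∀ j, |e h j| < r ^ d j} =
      e ⁻¹' (pi univ fun j => Ioo (-(r ^ d j)) (r ^ d j)) := by
    ext h
    simp [abs_lt]
  have hbox : MeasurableSet (pi univ fun j => Ioo (-(r ^ d j)) (r ^ d j)) :=
    MeasurableSet.univ_pi fun j => measurableSet_Ioo
  rw [hset, ← Measure.map_apply e.continuous.measurable hbox, hmap, Measure.smul_apply,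
    Real.volume_pi_Ioo, ENNReal.ofReal_mul κ.coe_nonneg, ENNReal.smul_def, smul_eq_mul,
    ENNReal.ofReal_coe_nnreal, ← Finset.prod_pow_eq_pow_sum,
    ENNReal.ofReal_prod_of_nonneg fun j _ => by positivity]
  gcongr with j
  linarith [pow_pos hr (d j)]

/-- The preimage contains a smaller linear box, cut out by the forms in `b` alone at scale a·r. -/
theorem exists_measure_box_preimage_ge [FiniteDimensional ℝ N] {ι : Type*} [Finite ι]
    (ℓ : ι → Module.Dual ℝ N)   {d : ι → ℕ} (hd : ∀ i, d i = 1 ∨ d i = 2) {X : N → ι → ℝ} {C : ℝ}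
    (hX : ∀ᶠ h in 𝓝 0, ∀ i, |X h i - ℓ i h| ≤ C * ‖h‖ ^ 2) {b : Finset ι}
    (hcard : b.card = Module.finrank ℝ N)
    (hspan : ∀ i, ℓ i ∈ Submodule.span ℝ (ℓ '' b))
    (hspan₂ : ∀ i ∈ {i | d i = 2}, ℓ i ∈ Submodule.span ℝ (ℓ '' (b ∩ {i | d i = 2})))
    (hsep : ∀ h, (∀ j ∈ b, ℓ j h = 0) → h = 0) {V : Set N} (hV : V ∈ 𝓝 0) {c₀ : ℝ}
    (hc₀ : 0 < c₀) :
    ∃ c : ℝ, 0 < c ∧ ∃ r₀ : ℝ, 0 < r₀ ∧ ∀ r, 0 < r → r < r₀ →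
      ENNReal.ofReal (c * r ^ ∑ j ∈ b, d j) ≤ μ {h | h ∈ V ∧ ∀ i, |X h i| < c₀ * r ^ d i} := by
  have := Fintype.ofFinite ι
  let M : N →ₗ[ℝ] (b → ℝ) := LinearMap.pi fun j => ℓ j
  have hM : Function.Injective M := by
    rw [← LinearMap.ker_eq_bot, LinearMap.ker_eq_bot']
    exact fun h hh => hsep h fun j hj => congrFun hh ⟨j, hj⟩
  let e : N ≃L[ℝ] (b → ℝ) :=
    (M.linearEquivOfInjective hM (by simp [hcard])).toContinuousLinearEquiv
  have he : ∀ h (j : b), e h j = ℓ j h := fun h j => rfl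
  obtain ⟨κ, hκ, hbox⟩ := exists_measure_anisotropic_box_ge μ e fun j : b => d j
  have hnorm : ∀ h ε, 0 ≤ ε → (∀ j ∈ b, |ℓ j h| ≤ ε) →
      ‖h‖ ≤ ‖(e.symm : (b → ℝ) →L[ℝ] N)‖ * ε := by
    intro h ε hε hh
    have h1 : ‖e h‖ ≤ ε := (pi_norm_le_iff_of_nonneg hε).mpr fun j => by
      rw [he, Real.norm_eq_abs]
      exact hh j j.2
    have h2 := (e.symm : (b → ℝ) →L[ℝ] N).le_opNorm (e h)
    rw [ContinuousLinearEquiv.coe_coe, e.symm_apply_apply] at h2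
    exact h2.trans (mul_le_mul_of_nonneg_left h1 (norm_nonneg _))
  set A := ‖(e.symm : (b → ℝ) →L[ℝ] N)‖
  have hA : 0 ≤ A := norm_nonneg _
  -- A form of weight 1 only needs all basis forms to be O(s). A form of weight 2 must be O(s²),
  -- which holds since it is a combination of basis forms of weight 2.
  have hlin : ∀ i, ∃ B : ℝ, 0 ≤ B ∧ ∀ h s, 0 < s → s ≤ 1 → (∀ j ∈ b, |ℓ j h| ≤ s ^ d j) →
      |ℓ i h| ≤ B * s ^ d i := by
    intro i
    rcases hd i with h1 | h2
    · obtain ⟨B, hB0, hB⟩ := exists_abs_le_of_mem_span (hspan i)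
      refine ⟨B, hB0, fun h s hs hs1 hh => ?_⟩
      rw [h1, pow_one]
      refine hB h s hs.le fun j hj => (hh j hj).trans ?_
      exact pow_le_of_le_one hs.le hs1 (by rcases hd j with h | h <;> omega)
    · obtain ⟨B, hB0, hB⟩ := exists_abs_le_of_mem_span (hspan₂ i h2)
      refine ⟨B, hB0, fun h s hs hs1 hh => ?_⟩
      rw [h2]
      refine hB h _ (sq_nonneg s) fun j hj => ?_
      have hj2 : d j = 2 := hj.2
      rw [← hj2]
      exact hh j hj.1
  choose B hB0 hB using hlin
  set D : ℝ := ∑ i, B i + |C| * A ^ 2 with hD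
  have hD0 : 0 ≤ D := add_nonneg (Finset.sum_nonneg fun i _ => hB0 i) (by positivity)
  obtain ⟨η, hη, hηV⟩ := Metric.mem_nhds_iff.mp (Filter.inter_mem hV hX)
  -- `D` collects the linear and quadratic constants; shrinking the scale by `a` pushes their total
  -- below `c₀`, since a^(d i) ≤ a.
  set a : ℝ := min 1 (c₀ / (D + 1)) with ha
  have ha0 : 0 < a := lt_min one_pos (by positivity)
  have haD : a * D < c₀ := by
    have h1 : a * (D + 1) ≤ c₀ := by
      rw [← le_div_iff₀ (by positivity)]
      exact min_le_right _ _
    linarith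
  refine ⟨κ * a ^ ∑ j ∈ b, d j, by positivity, min 1 (η / (A + 1)),
    lt_min one_pos (by positivity), fun r hr hr₀ => ?_⟩
  have hr1 : r ≤ 1 := (hr₀.trans_le (min_le_left _ _)).le
  have hs : 0 < a * r := mul_pos ha0 hr
  have har : a * r ≤ r := mul_le_of_le_one_left hr.le (min_le_left _ _)
  have hs1 : a * r ≤ 1 := har.trans hr1
  have hmeas := hbox (a * r) hs
  rw [Finset.sum_coe_sort b d, mul_pow, ← mul_assoc] at hmeas
  refine hmeas.trans (measure_mono fun h hh => ?_)
  have hh' : ∀ j ∈ b, |ℓ j h| ≤ (a * r) ^ d j := fun j hj => by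
    have := hh ⟨j, hj⟩
    rw [he] at this
    exact this.le
  have hnh : ‖h‖ ≤ A * (a * r) := hnorm h _ hs.le fun j hj => (hh' j hj).trans
    (pow_le_of_le_one hs.le hs1 (by rcases hd j with h | h <;> omega))
  have hmem : h ∈ Metric.ball (0 : N) η := by
    rw [mem_ball_zero_iff]
    have h1 : r * (A + 1) < η := by
      rw [← lt_div_iff₀ (by positivity)]
      exact hr₀.trans_le (min_le_right _ _)
    nlinarith [mul_le_mul_of_nonneg_left har hA]
  obtain ⟨hhV, hhX⟩ := hηV hmem
  refine ⟨hhV, fun i => ?_⟩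
  -- Weights at most 2 let the quadratic error be absorbed in every coordinate.
  have hdi : (a * r) ^ 2 ≤ (a * r) ^ d i :=
    pow_le_pow_of_le_one hs.le hs1 (by rcases hd i with h | h <;> omega)
  have hlow : a ^ d i ≤ a := pow_le_of_le_one ha0.le (min_le_left _ _)
    (by rcases hd i with h | h <;> omega)
  have h1 : |X h i - ℓ i h| ≤ |C| * A ^ 2 * (a * r) ^ d i := by
    calc |X h i - ℓ i h| ≤ C * ‖h‖ ^ 2 := hhX i
      _ ≤ |C| * (A * (a * r)) ^ 2 := by
        gcongr
        exact le_abs_self C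
      _ = |C| * A ^ 2 * (a * r) ^ 2 := by ring
      _ ≤ |C| * A ^ 2 * (a * r) ^ d i := by gcongr
  have h2 : |ℓ i h| ≤ (∑ i, B i) * (a * r) ^ d i := by
    refine (hB i h _ hs hs1 hh').trans ?_
    gcongr
    exact Finset.single_le_sum (fun i _ => hB0 i) (Finset.mem_univ i)
  calc |X h i| = |(X h i - ℓ i h) + ℓ i h| := by rw [sub_add_cancel]
    _ ≤ |X h i - ℓ i h| + |ℓ i h| := abs_add_le _ _
    _ ≤ D * (a * r) ^ d i := by rw [hD, add_mul, add_comm]; exact add_le_add h2 h1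
    _ = a ^ d i * D * r ^ d i := by rw [mul_pow]; ring
    _ ≤ a * D * r ^ d i := by gcongr
    _ < c₀ * r ^ d i := by gcongr

end Boxes

/-! ### Parametrizing level sets with quadratic error. -/

section LevelSets

variable {E F N : Type*} [NormedAddCommGroup E] [NormedSpace ℝ E]
  [NormedAddCommGroup F] [NormedSpace ℝ F] [NormedAddCommGroup N] [NormedSpace ℝ N]

theorem norm_fderiv_sub_le_of_lipschitzOnWith {f : E → F} {U : Set E} {K : ℝ≥0}
    (hf : ∀ z ∈ U, DifferentiableAt ℝ f z) (hK : LipschitzOnWith K (fderiv ℝ f) U) {x y : E}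
    (hseg : segment ℝ x y ⊆ U) :
    ‖f y - f x - fderiv ℝ f x (y - x)‖ ≤ K * ‖y - x‖ ^ 2 := by
  rw [pow_two, ← mul_assoc]
  refine (convex_segment x y).norm_image_sub_le_of_norm_fderiv_le' (fun z hz => hf z (hseg hz))
    (fun z hz => ?_) (left_mem_segment ℝ x y) (right_mem_segment ℝ x y)
  refine (hK.norm_sub_le (hseg hz) (hseg (left_mem_segment ℝ x y))).trans ?_
  gcongr
  obtain ⟨t, ht, rfl⟩ := (segment_eq_image' ℝ x y).subset hz
  rw [add_sub_cancel_left, norm_smul, Real.norm_of_nonneg ht.1]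
  exact mul_le_of_le_one_left (norm_nonneg _) ht.2

/-- Local parametrization of a `C^{1,1}` level set, with a second order expansion at each point of
the parameter domain. -/
theorem exists_local_parametrization [CompleteSpace E] {U : Set E} (hU : IsOpen U) {f : E → F} {K : ℝ≥0}
    (hf : ContDiffOn ℝ 1 f U) (hK : LipschitzOnWith K (fderiv ℝ f) U) {x₀ : E} (hx₀ : x₀ ∈ U)
    (π : E →L[ℝ] N) (G : E ≃L[ℝ] F × N)
    (hG : (G : E →L[ℝ] F × N) = (fderiv ℝ f x₀).prod π) :
    ∃ (V : Set E) (Ω : Set N) (Φ : N → E), IsOpen V ∧ x₀ ∈ V ∧ V ⊆ U ∧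
      IsOpen Ω ∧ Bornology.IsBounded Ω ∧ ContinuousOn Φ Ω ∧ (∀ k ∈ Ω, Φ k ∈ V ∧ f (Φ k) = 0) ∧
      (∀ y ∈ V, f y = 0 → ∃ k ∈ Ω, Φ k = y) ∧
      ∀ k ∈ Ω, ∃ L : N →L[ℝ] E, Function.Injective L ∧
        LinearMap.range (L : N →ₗ[ℝ] E) = LinearMap.ker (fderiv ℝ f (Φ k) : E →ₗ[ℝ] F) ∧
        ∃ C : ℝ, ∀ᶠ h in 𝓝 0, ‖Φ (k + h) - Φ k - L h‖ ≤ C * ‖h‖ ^ 2 := by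
  have hdiff : ∀ z ∈ U, DifferentiableAt ℝ f z := fun z hz =>
    (hf.differentiableOn one_ne_zero z hz).differentiableAt (hU.mem_nhds hz)
  have hstrict : HasStrictFDerivAt (fun y => (f y, π y)) (G : E →L[ℝ] F × N) x₀ := by
    rw [hG]
    exact ((hf.contDiffAt (hU.mem_nhds hx₀)).hasStrictFDerivAt one_ne_zero).prodMk
      π.hasStrictFDerivAt
  let e := hstrict.toOpenPartialHomeomorph _
  have he : ∀ y, e y = (f y, π y) := fun y => rfl
  let R : Set (E →L[ℝ] F × N) := range ((↑) : (E ≃L[ℝ] F × N) → E →L[ℝ] F × N)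
  have hcont : ContinuousOn (fun y => (fderiv ℝ f y).prod π) U :=
    (ContinuousLinearMap.prodₗᵢ ℝ).continuous.comp_continuousOn
      ((hf.continuousOn_fderiv_of_isOpen hU le_rfl).prodMk continuousOn_const)
  -- The unit ball keeps the parameter domain bounded, hence of finite measure; the last condition
  -- keeps (df, π) invertible at every point, not only at `x₀`.
  let V : Set E := (e.source ∩ Metric.ball x₀ 1) ∩
    (U ∩ (fun y => (fderiv ℝ f y).prod π) ⁻¹' R)
  have hVo : IsOpen V := (e.open_source.inter Metric.isOpen_ball).inter
    (hcont.isOpen_inter_preimage hU ContinuousLinearEquiv.isOpen)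
  let i : N → F × N := fun k => (0, k)
  have hi : Continuous i := by fun_prop
  let Ω : Set N := i ⁻¹' (e.target ∩ e.symm ⁻¹' V)
  let Φ : N → E := fun k => e.symm (i k)
  have hΩo : IsOpen Ω := (e.isOpen_inter_preimage_symm hVo).preimage hi
  have heΦ : ∀ k ∈ Ω, f (Φ k) = 0 ∧ π (Φ k) = k := by
    intro k hk
    have h1 : e (e.symm (i k)) = i k := e.right_inv hk.1
    rw [he] at h1
    exact Prod.ext_iff.mp h1
  have hΦc : ContinuousOn Φ Ω :=
    e.continuousOn_symm.comp hi.continuousOn fun k hk => hk.1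
  refine ⟨V, Ω, Φ, hVo, ⟨⟨hstrict.mem_toOpenPartialHomeomorph_source, Metric.mem_ball_self one_pos⟩,
    hx₀, ⟨G, hG⟩⟩, fun y hy => hy.2.1, hΩo, ?_, hΦc, fun k hk => ⟨hk.2, (heΦ k hk).1⟩, ?_, ?_⟩
  · exact (π.lipschitz.isBounded_image (Metric.isBounded_ball (x := x₀) (r := 1))).subset
      fun k hk => ⟨Φ k, hk.2.1.2, (heΦ k hk).2⟩
  · intro y hy hfy
    have h1 : e y = i (π y) := by rw [he, hfy]
    have h2 : e.symm (i (π y)) = y := by rw [← h1, e.left_inv hy.1.1]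
    exact ⟨π y, ⟨h1 ▸ e.map_source hy.1.1, by rw [mem_preimage, h2]; exact hy⟩, h2⟩
  · intro k hk
    obtain ⟨hxU, A, hA⟩ := hk.2.2
    have hxU : Φ k ∈ U := hxU
    have hA : (A : E →L[ℝ] F × N) = (fderiv ℝ f (Φ k)).prod π := hA
    have hAv : ∀ v, A v = (fderiv ℝ f (Φ k) v, π v) := fun v =>
      DFunLike.congr_fun hA v
    let B : F × N →L[ℝ] E := A.symm
    have hBA : ∀ v, B (fderiv ℝ f (Φ k) v, π v) = v := fun v => by
      rw [← hAv]
      exact A.symm_apply_apply v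
    have hAB : ∀ n, fderiv ℝ f (Φ k) (B (0, n)) = 0 ∧ π (B (0, n)) = n := fun n => by
      have h1 : A (B (0, n)) = (0, n) := A.apply_symm_apply _
      rw [hAv] at h1
      exact Prod.ext_iff.mp h1
    refine ⟨B.comp (ContinuousLinearMap.inr ℝ F N), fun m n hmn => ?_, ?_, ?_⟩
    · have h1 : B (0, m) = B (0, n) := hmn
      rw [← (hAB m).2, h1, (hAB n).2]
    · ext v
      refine ⟨?_, fun hv => ⟨π v, ?_⟩⟩
      · rintro ⟨n, rfl⟩
        exact (hAB n).1
      · have hv : fderiv ℝ f (Φ k) v = 0 := hv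
        have h1 := hBA v
        rw [hv] at h1
        exact h1
    · refine ⟨‖B‖ * K * (2 * ‖B‖) ^ 2, ?_⟩
      obtain ⟨ε, hε, hεU⟩ := Metric.isOpen_iff.mp hU _ hxU
      have hΦk : Tendsto (fun h => Φ (k + h)) (𝓝 0) (𝓝 (Φ k)) := by
        have h1 : Tendsto (fun h => k + h) (𝓝 0) (𝓝 k) := by
          simpa using (continuous_const_add k).tendsto 0
        exact (hΦc.continuousAt (hΩo.mem_nhds hk)).tendsto.comp h1
      have hΩk : ∀ᶠ h in 𝓝 (0 : N), k + h ∈ Ω := by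
        have h1 : Tendsto (fun h => k + h) (𝓝 0) (𝓝 k) := by
          simpa using (continuous_const_add k).tendsto 0
        exact h1 (hΩo.mem_nhds hk)
      -- The radius is chosen so that ‖B‖ K ‖w‖ ≤ 1/2, which allows ‖w‖ to be absorbed and bounded
      -- by 2‖B‖‖h‖.
      have hball := hΦk (Metric.ball_mem_nhds _
        (lt_min hε (by positivity : (0 : ℝ) < 1 / (2 * (‖B‖ * K + 1)))))
      filter_upwards [hΩk, hball] with h hh1 hh2
      rw [mem_preimage, Metric.mem_ball, dist_eq_norm] at hh2
      set w := Φ (k + h) - Φ k with hw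
      have hseg : segment ℝ (Φ k) (Φ (k + h)) ⊆ U := by
        refine ((convex_ball (Φ k) ε).segment_subset (Metric.mem_ball_self hε) ?_).trans hεU
        rw [Metric.mem_ball, dist_eq_norm]
        exact hh2.trans_le (min_le_left _ _)
      have hT := norm_fderiv_sub_le_of_lipschitzOnWith hdiff hK hseg
      rw [(heΦ k hk).1, (heΦ _ hh1).1, sub_zero, zero_sub, norm_neg, ← hw] at hT
      have hπ : π w = h := by
        rw [hw, map_sub, (heΦ k hk).2, (heΦ _ hh1).2, add_sub_cancel_left]
      -- Since π w = h, the error is the image of df(w) alone, and df(w) is quadratic in w because f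
      -- vanishes at both endpoints.
      have herr : w - B (0, h) = B (fderiv ℝ f (Φ k) w, 0) := by
        conv_lhs => rw [← hBA w]
        rw [← map_sub, hπ, Prod.mk_sub_mk, sub_zero, sub_self]
      have hn1 : ‖w - B (0, h)‖ ≤ ‖B‖ * K * ‖w‖ ^ 2 := by
        rw [herr, mul_assoc]
        refine (B.le_opNorm _).trans ?_
        gcongr
        rw [Prod.norm_mk, norm_zero, max_eq_left (norm_nonneg _)]
        exact hT
      have hn2 : ‖B (0, h)‖ ≤ ‖B‖ * ‖h‖ := by
        refine (B.le_opNorm _).trans_eq ?_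
        rw [Prod.norm_mk, norm_zero, max_eq_right (norm_nonneg _)]
      have hBK : 0 ≤ ‖B‖ * K := by positivity
      have hsmall : ‖w‖ * (2 * (‖B‖ * K + 1)) < 1 := by
        rw [← lt_div_iff₀ (by positivity)]
        exact hh2.trans_le (min_le_right _ _)
      have hw2 : ‖w‖ ≤ 2 * ‖B‖ * ‖h‖ := by
        have h1 : ‖w‖ ≤ ‖w - B (0, h)‖ + ‖B (0, h)‖ := by
          simpa using norm_add_le (w - B (0, h)) (B (0, h))
        have h2 : ‖B‖ * K * ‖w‖ ^ 2 ≤ ‖w‖ / 2 := by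
          nlinarith [norm_nonneg w, mul_nonneg hBK (norm_nonneg w)]
        linarith
      calc ‖w - B (0, h)‖ ≤ ‖B‖ * K * ‖w‖ ^ 2 := hn1
        _ ≤ ‖B‖ * K * (2 * ‖B‖ * ‖h‖) ^ 2 := by gcongr
        _ = ‖B‖ * K * (2 * ‖B‖) ^ 2 * ‖h‖ ^ 2 := by ring

end LevelSets

theorem hasFDerivAt_of_eventually_norm_le_sq {E N : Type*} [NormedAddCommGroup E] [NormedSpace ℝ E]
    [NormedAddCommGroup N] [NormedSpace ℝ N] {Φ : N → E} {L : N →L[ℝ] E} {k : N} {C : ℝ}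
    (h : ∀ᶠ h in 𝓝 0, ‖Φ (k + h) - Φ k - L h‖ ≤ C * ‖h‖ ^ 2) : HasFDerivAt Φ L k := by
  rw [hasFDerivAt_iff_isLittleO_nhds_zero]
  refine Asymptotics.IsBigO.trans_isLittleO (g := fun h : N => ‖h‖ ^ 2) ?_
    (Asymptotics.isLittleO_norm_pow_id one_lt_two)
  refine Asymptotics.IsBigO.of_bound C ?_
  filter_upwards [h] with h hh
  simpa using hh

/-- π is a linear projection onto the kernel of `A`, followed by an identification of that kernel
with `N`. -/
theorem exists_prod_equiv_of_surjective {E F N : Type*}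
    [NormedAddCommGroup E] [NormedSpace ℝ E] [FiniteDimensional ℝ E]
    [NormedAddCommGroup F] [NormedSpace ℝ F] [FiniteDimensional ℝ F]
    [NormedAddCommGroup N] [NormedSpace ℝ N] [FiniteDimensional ℝ N]
    (A : E →L[ℝ] F) (hA : Function.Surjective A)
    (hdim : Module.finrank ℝ E = Module.finrank ℝ F + Module.finrank ℝ N) :
    ∃ (π : E →L[ℝ] N) (G : E ≃L[ℝ] F × N), (G : E →L[ℝ] F × N) = A.prod π := by
  have hker : Module.finrank ℝ (LinearMap.ker (A : E →ₗ[ℝ] F)) = Module.finrank ℝ N := by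
    have h1 := LinearMap.finrank_range_add_finrank_ker (A : E →ₗ[ℝ] F)
    rw [LinearMap.range_eq_top.mpr hA, finrank_top] at h1
    omega
  let ε := LinearEquiv.ofFinrankEq _ _ hker
  obtain ⟨s, hs⟩ := (LinearMap.ker (A : E →ₗ[ℝ] F)).subtype.exists_leftInverse_of_injective
    (Submodule.ker_subtype _)
  let π : E →ₗ[ℝ] N := ε.toLinearMap.comp s
  let P : E →ₗ[ℝ] F × N := (A : E →ₗ[ℝ] F).prod π
  have hP : Function.Injective P := by
    rw [← LinearMap.ker_eq_bot, LinearMap.ker_eq_bot']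
    intro v hv
    obtain ⟨h1, h2⟩ := Prod.ext_iff.mp hv
    have h3 : s v = 0 := ε.map_eq_zero_iff.mp h2
    have h4 := LinearMap.congr_fun hs ⟨v, h1⟩
    have h5 : s v = ⟨v, h1⟩ := h4
    rw [h3] at h5
    exact (congrArg Subtype.val h5).symm
  refine ⟨LinearMap.toContinuousLinearMap π,
    (P.linearEquivOfInjective hP (by rw [Module.finrank_prod, hdim])).toContinuousLinearEquiv, ?_⟩
  ext v <;> rfl

/-! ### Tangent spaces, ball estimate and countable decomposition. -/

namespace TwoStepStratification

variable {𝔤 : Type*} [LieRing 𝔤] [LieAlgebra ℝ 𝔤] {S : TwoStepStratification 𝔤}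

namespace GradedBasis

variable {q : ℕ} {W : S.GradedBasis q}

/-- Differentiating f ∘ γ = 0 puts velocities in the kernel of df; conversely Φ maps lines through k
to curves in Σ with any velocity in the range of `L`. -/
theorem tangentSpace_eq_range {F N : Type*} [NormedAddCommGroup F] [NormedSpace ℝ F]
    [NormedAddCommGroup N] [NormedSpace ℝ N] {Sig : Set S.Grp}
    {U : Set (EuclideanSpace ℝ (Fin q))} {f : EuclideanSpace ℝ (Fin q) → F} (hU : IsOpen U)
    (hfS : ∀ y ∈ U, W.coord y ∈ Sig ↔ f y = 0) {Φ : N → EuclideanSpace ℝ (Fin q)} {k : N}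
    (hk : Φ k ∈ U) (hf : DifferentiableAt ℝ f (Φ k)) (hΦ : ∀ᶠ k' in 𝓝 k, W.coord (Φ k') ∈ Sig)
    {L : N →L[ℝ] EuclideanSpace ℝ (Fin q)} (hL : HasFDerivAt Φ L k)
    (hrange : LinearMap.range (L : N →ₗ[ℝ] EuclideanSpace ℝ (Fin q)) =
      LinearMap.ker (fderiv ℝ f (Φ k) : EuclideanSpace ℝ (Fin q) →ₗ[ℝ] F)) :
    W.tangentSpace Sig (W.coord (Φ k)) =
      LinearMap.range (L : N →ₗ[ℝ] EuclideanSpace ℝ (Fin q)) := by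
  refine le_antisymm (Submodule.span_le.mpr ?_) ?_
  · rintro v ⟨γ, hγ0, hγS, hγ⟩
    rw [Equiv.symm_apply_apply] at hγ0
    rw [hrange]
    have hcomp : HasDerivAt (f ∘ γ) (fderiv ℝ f (Φ k) v) 0 := by
      rw [← hγ0] at hf ⊢
      exact hf.hasFDerivAt.comp_hasDerivAt 0 hγ
    have hzero : f ∘ γ =ᶠ[𝓝 0] fun _ => 0 := by
      have hγU : ∀ᶠ t in 𝓝 0, γ t ∈ U :=
        hγ.continuousAt.eventually_mem (hU.mem_nhds (hγ0 ▸ hk))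
      filter_upwards [hγS, hγU] with t h1 h2
      exact (hfS _ h2).mp h1
    exact hcomp.unique ((hasDerivAt_const (0 : ℝ) (0 : F)).congr_of_eventuallyEq hzero)
  · rintro _ ⟨n, rfl⟩
    have hline : HasDerivAt (fun t : ℝ => k + t • n) n 0 := by
      simpa using ((hasDerivAt_id (0 : ℝ)).smul_const n).const_add k
    have h0 : k + (0 : ℝ) • n = k := by simp
    refine Submodule.subset_span ⟨fun t => Φ (k + t • n), ?_, ?_, ?_⟩
    · rw [Equiv.symm_apply_apply]
      exact congrArg Φ h0
    · have ht : Tendsto (fun t : ℝ => k + t • n) (𝓝 0) (𝓝 k) := by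
        have h1 := hline.continuousAt.tendsto
        rwa [h0] at h1
      exact ht.eventually hΦ
    · rw [← h0] at hL
      exact hL.comp_hasDerivAt 0 hline

namespace HomogeneousDistance

/-- The volume, read in a local parametrization, of a ball centered at a point of degree at most `δ`
is at least comparable with `r ^ δ`. -/
theorem exists_measure_ball_ge (D : W.HomogeneousDistance) {N : Type*} [NormedAddCommGroup N]
    [NormedSpace ℝ N] [FiniteDimensional ℝ N] [MeasurableSpace N] [BorelSpace N] (μ : Measure N)
    [μ.IsAddHaarMeasure] {Sig : Set S.Grp} {Ω : Set N} {Φ : N → EuclideanSpace ℝ (Fin q)} {k : N}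
    (hΩ : Ω ∈ 𝓝 k) {L : N →L[ℝ] EuclideanSpace ℝ (Fin q)} (hinj : Function.Injective L)
    (htan : W.tangentSpace Sig (W.coord (Φ k)) =
      LinearMap.range (L : N →ₗ[ℝ] EuclideanSpace ℝ (Fin q)))
    {C : ℝ} (hC : ∀ᶠ h in 𝓝 0, ‖Φ (k + h) - Φ k - L h‖ ≤ C * ‖h‖ ^ 2) {δ : ℕ}
    (hδ : W.pointDegree (Module.finrank ℝ N) Sig (W.coord (Φ k)) ≤ δ) :
    ∃ n : ℕ, ∀ r : ℝ, 0 < r → r < 1 / (n + 1) →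
      ENNReal.ofReal (1 / (n + 1) * r ^ δ) ≤
        μ {k' | k' ∈ Ω ∧ D.ρ (W.coord (Φ k)) (W.coord (Φ k')) < r} := by
  set x := W.coord (Φ k) with hx
  -- The differential of Φ read in the left invariant frame at x; its range is the tangent space
  -- inside `𝔤`.
  let Λ : N →ₗ[ℝ] 𝔤 := (W.leftInvariantEquiv x).symm.toLinearMap.comp L.toLinearMap
  have hΛ : Function.Injective Λ := (W.leftInvariantEquiv x).symm.injective.comp hinj
  have hrange : W.tangentAlg Sig x = LinearMap.range Λ := by
    rw [tangentAlg, htan, leftInvariant_eq, LinearMap.range_comp]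
    exact Submodule.comap_equiv_eq_map_symm _ _
  have hfin : Module.finrank ℝ (W.tangentAlg Sig x) = Module.finrank ℝ N := by
    rw [hrange, LinearMap.finrank_range_of_inj hΛ]
  let ℓ : Fin q → Module.Dual ℝ N := fun i => (W.basis.coord i).comp Λ
  have hsep : ∀ h, (∀ i, ℓ i h = 0) → h = 0 := by
    intro h hh
    apply hΛ
    rw [map_zero]
    exact W.basis.repr.map_eq_zero_iff.mp (Finsupp.ext hh)
  obtain ⟨b, hbcard, hb1, hb2, hb3⟩ :=
    exists_finset_linearForms_basis ℓ hsep {i | W.deg i = 2}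
  have hdeg : ∑ j ∈ b, W.deg j ≤ δ := by
    refine (W.sum_deg_le_pointDegree hfin hbcard ?_).trans hδ
    rw [hrange]
    rintro _ ⟨h, rfl⟩ hh
    rw [hb3 h hh, map_zero]
  let X : N → Fin q → ℝ := fun h i =>
    W.basis.repr ((W.leftInvariantEquiv x).symm (Φ (k + h) - Φ k)) i
  have hX : ∃ C' : ℝ, ∀ᶠ h in 𝓝 0, ∀ i, |X h i - ℓ i h| ≤ C' * ‖h‖ ^ 2 := by
    let T : EuclideanSpace ℝ (Fin q) →L[ℝ] (Fin q → ℝ) := LinearMap.toContinuousLinearMap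
      (W.basis.equivFun.toLinearMap.comp (W.leftInvariantEquiv x).symm.toLinearMap)
    refine ⟨‖T‖ * C, ?_⟩
    filter_upwards [hC] with h hh i
    have h1 : X h i - ℓ i h = T (Φ (k + h) - Φ k - L h) i := by
      rw [map_sub]
      rfl
    rw [h1, ← Real.norm_eq_abs, mul_assoc]
    exact (norm_le_pi_norm _ i).trans ((T.le_opNorm _).trans (by gcongr))
  obtain ⟨C', hC'⟩ := hX
  obtain ⟨c₀, hc₀, hball⟩ := D.exists_lt_of_coords_lt
  have hV : (fun h => k + h) ⁻¹' Ω ∈ 𝓝 (0 : N) := by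
    have h1 : Tendsto (fun h => k + h) (𝓝 0) (𝓝 k) := by
      simpa using (continuous_const_add k).tendsto 0
    exact h1 hΩ
  obtain ⟨c, hc, r₀, hr₀, hlow⟩ := exists_measure_box_preimage_ge μ ℓ W.deg_eq_one_or_two hC'
    hbcard hb1 hb2 hb3 hV hc₀
  -- A single integer controls both the constant and the range of radii, so that the decomposition
  -- by n is countable.
  obtain ⟨n, hn⟩ := exists_nat_one_div_lt (lt_min hc hr₀)
  refine ⟨n, fun r hr hrn => ?_⟩
  have hr1 : r ≤ 1 := hrn.le.trans (by
    rw [div_le_one (by positivity)]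
    linarith [(Nat.cast_nonneg n : (0 : ℝ) ≤ n)])
  have hnc : 1 / ((n : ℝ) + 1) ≤ c := hn.le.trans (min_le_left _ _)
  have hrr₀ : r < r₀ := hrn.trans (hn.trans_le (min_le_right _ _))
  calc ENNReal.ofReal (1 / (n + 1) * r ^ δ)
      ≤ ENNReal.ofReal (c * r ^ ∑ j ∈ b, W.deg j) := by
        refine ENNReal.ofReal_le_ofReal (mul_le_mul hnc ?_ (by positivity) hc.le)
        exact pow_le_pow_of_le_one hr.le hr1 hdeg
    _ ≤ μ {h | h ∈ (fun h => k + h) ⁻¹' Ω ∧ ∀ i, |X h i| < c₀ * r ^ W.deg i} := hlow r hr hrr₀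
    _ ≤ μ ((fun h => k + h) ⁻¹' {k' | k' ∈ Ω ∧ D.ρ x (W.coord (Φ k')) < r}) := by
        refine measure_mono fun h hh => ⟨hh.1, ?_⟩
        have h1 := hball r hr _ hh.2
        rw [← D.left_invariant x⁻¹, inv_mul_cancel, inv_mul_coord]
        rwa [hx, Equiv.symm_apply_apply]
    _ = μ {k' | k' ∈ Ω ∧ D.ρ x (W.coord (Φ k')) < r} := measure_preimage_add μ k _

/-- Pulled back balls are measurable because ρ is continuous in graded coordinates, so the metric
and coordinate topologies need not be compared. -/
theorem hausdorff_lt_top (D : W.HomogeneousDistance) {N : Type*} [TopologicalSpace N]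
    [MeasurableSpace N] [OpensMeasurableSpace N] {μ : Measure N} {Ω : Set N} (hΩo : IsOpen Ω)
    (hΩ : μ Ω ≠ ∞) {Φ : N → EuclideanSpace ℝ (Fin q)} (hΦ : ContinuousOn Φ Ω) {A : Set S.Grp}
    {δ : ℕ} {c r₀ : ℝ} (hc : 0 < c) (hr₀ : 0 < r₀)
    (hlow : ∀ x ∈ A, ∀ r : ℝ, 0 < r → r < r₀ →
      ENNReal.ofReal (c * r ^ δ) ≤ μ {k | k ∈ Ω ∧ D.ρ x (W.coord (Φ k)) < r}) :
    D.hausdorff δ A < ∞ := by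
  let _ : MetricSpace S.Grp := D.metricSpace
  let _ : MeasurableSpace S.Grp := borel S.Grp
  have : BorelSpace S.Grp := ⟨rfl⟩
  have hset : ∀ x r, Ω ∩ (fun k => W.coord (Φ k)) ⁻¹' Metric.ball x r =
      {k | k ∈ Ω ∧ D.ρ x (W.coord (Φ k)) < r} := by
    intro x r
    ext k
    change k ∈ Ω ∧ D.ρ (W.coord (Φ k)) x < r ↔ k ∈ Ω ∧ D.ρ x (W.coord (Φ k)) < r
    rw [D.symm]
  refine hausdorffMeasure_lt_top_of_forall_le_measure (Φ := fun k => W.coord (Φ k))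
    (Nat.cast_nonneg δ) hc hr₀ hΩ (fun x _ r => ?_) fun x hx r hr hrr₀ => ?_
  · rw [hset]
    have hcont : ContinuousOn (fun k => D.ρ x (W.coord (Φ k))) Ω := by
      have h1 : ContinuousOn (fun k => (W.coord.symm x, Φ k)) Ω := continuousOn_const.prodMk hΦ
      have h2 := D.continuous.comp_continuousOn h1
      simpa only [Function.comp_def, Equiv.apply_symm_apply] using h2
    exact (hcont.isOpen_inter_preimage hΩo isOpen_Iio).measurableSet
  · rw [hset, Real.rpow_natCast]
    exact hlow x hx r hr hrr₀

theorem CountablyFinite.iUnion {D : W.HomogeneousDistance} {s : ℝ} {A : ℕ → Set S.Grp}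
    (h : ∀ n, D.CountablyFinite s (A n)) : D.CountablyFinite s (⋃ n, A n) := by
  choose B hB hfin using h
  refine ⟨fun n => B n.unpair.1 n.unpair.2, ?_, fun n => hfin _ _⟩
  rw [Set.iUnion_unpair]
  exact iUnion_congr hB

theorem CountablyFinite.hausdorffDim_le {D : W.HomogeneousDistance} {s : ℝ≥0} {A : Set S.Grp}
    (h : D.CountablyFinite s A) : D.hausdorffDim A ≤ s := by
  let _ : MetricSpace S.Grp := D.metricSpace
  let _ : MeasurableSpace S.Grp := borel S.Grp
  have : BorelSpace S.Grp := ⟨rfl⟩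
  obtain ⟨B, rfl, hB⟩ := h
  change dimH (⋃ n, B n) ≤ s
  rw [dimH_iUnion]
  exact iSup_le fun n => dimH_le_of_hausdorffMeasure_ne_top (hB n).ne

theorem exists_chart_countablyFinite (D : W.HomogeneousDistance) {p : ℕ} {Sig : Set S.Grp}
    (hSig : W.IsC11Submanifold p Sig) (δ : ℕ) {x₀ : S.Grp} (hx₀ : x₀ ∈ Sig) :
    ∃ V : Set (EuclideanSpace ℝ (Fin q)), IsOpen V ∧ W.coord.symm x₀ ∈ V ∧
      D.CountablyFinite (δ : ℝ)
        ({x ∈ Sig | W.pointDegree p Sig x ≤ δ} ∩ W.coord.symm ⁻¹' V) := by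
  obtain ⟨hpq, hloc⟩ := hSig
  obtain ⟨U, f, K, hU, hx₀U, hf, hK, hsurj, hfS⟩ := hloc x₀ hx₀
  have hf0 : f (W.coord.symm x₀) = 0 :=
    (hfS _ hx₀U).mp (by rwa [Equiv.apply_symm_apply])
  obtain ⟨π, G, hG⟩ := exists_prod_equiv_of_surjective (N := EuclideanSpace ℝ (Fin p))
    (fderiv ℝ f (W.coord.symm x₀)) (hsurj _ hx₀U hf0) (by
      simp only [finrank_euclideanSpace_fin]
      omega)
  obtain ⟨V, Ω, Φ, hV, hx₀V, hVU, hΩo, hΩb, hΦc, hΦV, hVΦ, hΦL⟩ :=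
    exists_local_parametrization hU hf hK hx₀U π G hG
  have hΦS : ∀ k ∈ Ω, W.coord (Φ k) ∈ Sig := fun k hk =>
    (hfS _ (hVU (hΦV k hk).1)).mpr (hΦV k hk).2
  let μ : Measure (EuclideanSpace ℝ (Fin p)) := volume
  -- The n-th piece consists of the points where 1/(n+1) serves both as constant and as radius
  -- threshold.
  let B : ℕ → Set S.Grp := fun n =>
    {x ∈ {x ∈ Sig | W.pointDegree p Sig x ≤ δ} ∩ W.coord.symm ⁻¹' V |
      ∀ r : ℝ, 0 < r → r < 1 / ((n : ℝ) + 1) → ENNReal.ofReal (1 / (n + 1) * r ^ δ) ≤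
        μ {k | k ∈ Ω ∧ D.ρ x (W.coord (Φ k)) < r}}
  refine ⟨V, hV, hx₀V, B, subset_antisymm ?_ (iUnion_subset fun n x hx => hx.1), fun n => ?_⟩
  · intro x hx
    have hxV : W.coord.symm x ∈ V := hx.2
    obtain ⟨k, hk, hkx⟩ := hVΦ _ hxV ((hfS _ (hVU hxV)).mp (by
      rw [Equiv.apply_symm_apply]
      exact hx.1.1))
    have hkx' : W.coord (Φ k) = x := by rw [hkx, Equiv.apply_symm_apply]
    obtain ⟨L, hLinj, hLrange, C, hC⟩ := hΦL k hk
    have hkU : Φ k ∈ U := hVU (hΦV k hk).1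
    have htan : W.tangentSpace Sig (W.coord (Φ k)) = LinearMap.range L.toLinearMap :=
      tangentSpace_eq_range hU hfS hkU
        ((hf.differentiableOn one_ne_zero _ hkU).differentiableAt (hU.mem_nhds hkU))
        (by filter_upwards [hΩo.mem_nhds hk] with k' hk' using hΦS k' hk')
        (hasFDerivAt_of_eventually_norm_le_sq hC) hLrange
    obtain ⟨n, hn⟩ := D.exists_measure_ball_ge μ (hΩo.mem_nhds hk) hLinj htan hC (δ := δ) (by
      rw [finrank_euclideanSpace_fin, hkx']
      exact hx.1.2)
    rw [hkx'] at hn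
    exact mem_iUnion.mpr ⟨n, hx, hn⟩
  · exact D.hausdorff_lt_top hΩo hΩb.measure_lt_top.ne hΦc (by positivity) (by positivity)
      fun x hx => hx.2

end HomogeneousDistance

end GradedBasis

end TwoStepStratification

end

theorem corollary1p3 {𝔤 : Type*} [LieRing 𝔤] [LieAlgebra ℝ 𝔤] (S : TwoStepStratification 𝔤)
    {q : ℕ} (W : S.GradedBasis q) (D : W.HomogeneousDistance)
    (p : ℕ) (Sig : Set S.Grp) (hSig : W.IsC11Submanifold p Sig)
    (δ : ℕ) (hδ : 0 < δ) :
    D.CountablyFinite (δ : ℝ) {x ∈ Sig | W.pointDegree p Sig x ≤ δ} ∧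
      D.hausdorffDim {x ∈ Sig | W.pointDegree p Sig x ≤ δ} ≤ (δ : ℝ≥0∞) := by
  have hfin : D.CountablyFinite (δ : ℝ) {x ∈ Sig | W.pointDegree p Sig x ≤ δ} := by
    set Z := {x ∈ Sig | W.pointDegree p Sig x ≤ δ} with hZ
    -- A nonempty set is needed to enumerate the countable family of charts by ℕ.
    rcases Z.eq_empty_or_nonempty with hemp | hne
    · rw [hemp]
      refine ⟨fun _ => ∅, by simp, fun _ => ?_⟩
      rw [TwoStepStratification.GradedBasis.HomogeneousDistance.hausdorff, measure_empty]
      exact ENNReal.zero_lt_top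
    have hchart : ∀ y : W.coord.symm '' Z, ∃ V : Set (EuclideanSpace ℝ (Fin q)),
        IsOpen V ∧ (y : EuclideanSpace ℝ (Fin q)) ∈ V ∧
          D.CountablyFinite (δ : ℝ) (Z ∩ W.coord.symm ⁻¹' V) := by
      rintro ⟨_, x, hx, rfl⟩
      exact D.exists_chart_countablyFinite hSig δ hx.1
    choose V hVo hyV hV using hchart
    obtain ⟨T, hTc, hTV⟩ := TopologicalSpace.isOpen_iUnion_countable V hVo
    obtain ⟨x₁, hx₁⟩ := hne
    have hTne : T.Nonempty := by
      have h1 := mem_iUnion.mpr ⟨_, hyV ⟨W.coord.symm x₁, x₁, hx₁, rfl⟩⟩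
      rw [← hTV] at h1
      obtain ⟨t, ht, -⟩ := mem_iUnion₂.mp h1
      exact ⟨t, ht⟩
    obtain ⟨g, rfl⟩ := hTc.exists_eq_range hTne
    have hcov : Z = ⋃ n, Z ∩ W.coord.symm ⁻¹' V (g n) := by
      refine subset_antisymm (fun x hx => ?_) (iUnion_subset fun n => inter_subset_left)
      have h1 := mem_iUnion.mpr ⟨_, hyV ⟨W.coord.symm x, x, hx, rfl⟩⟩
      rw [← hTV, biUnion_range] at h1
      obtain ⟨n, hn⟩ := mem_iUnion.mp h1
      exact mem_iUnion.mpr ⟨n, hx, hn⟩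
    rw [hcov]
    exact .iUnion fun n => hV (g n)
  refine ⟨hfin, ?_⟩
  have h := TwoStepStratification.GradedBasis.HomogeneousDistance.CountablyFinite.hausdorffDim_le
    (s := (δ : ℝ≥0)) (by simpa using hfin)
  simpa using h
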